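/- Let $\mathcal H$ be a real Hilbert space and let $S:\mathcal H\to\mathcal H$ be a bounded linear self-adjoint operator that is strongly monotone, i.e. $\langle Sx,x\rangle\ge c\|x\|^2$ for some $c>0$ and all $x$. Write $\|x\|_S=\sqrt{\langle Sx,x\rangle}$ and $\|x\|_{S^{-1}}=\sqrt{\langle S^{-1}x,x\rangle}$. Call $T:\mathcal H\to\mathcal H$ $L$-Lipschitz w.r.t. $S$ if $\|Tx-Ty\|_{S^{-1}}\le L\|x-y\|_S$ for all $x,y$, and $\beta^{-1}$-cocoercive w.r.t. $S$ if $\langle Tx-Ty,x-y\rangle\ge\beta^{-1}\|Tx-Ty\|_{S^{-1}}^2$ for all $x,y$. Let $A:\mathcal H\to2^{\mathcal H}$ be maximally monotone, let $B:\mathcal H\to\mathcal H$ be monotone and $\mu$-Lipschitz w.r.t. $S$ for some $\mu>0$, let $C:\mathcal H\to\mathcal H$ be $\beta^{-1}$-cocoercive w.r.t. $S$ for some $\beta>0$, and suppose that $\operatorname{zer}(A+B+C)=\{x: 0\in Ax+Bx+Cx\}$ is nonempty. Let $\gamma>0$, and for every $k\in\mathbb N=\{0,1,2,\dots\}$ let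 $M_k:\mathcal H\to\mathcal H$ be such that $\gamma M_k-S$ is $L_k$-Lipschitz w.r.t. $S$ with $L_k\in[0,1)$. Given arbitrary $x_{-1},x_0,u_0\in\mathcal H$, let the sequences $(x_k)$, $(y_k)$, $(u_k)$ be generated, for $k=0,1,2,\dots$, by $$y_k=(M_k+A)^{-1}\bigl(M_kx_k-(B+C)x_k+\gamma^{-1}u_k\bigr),$$ $$x_{k+1}=y_k-\gamma S^{-1}Bx_k+\gamma S^{-1}Bx_{k-1},$$ $$u_{k+1}=(\gamma M_k-S)y_k-(\gamma M_k-S)x_k.$$ Suppose that there are constants $\varepsilon_5,\varepsilon_6,\alpha,\epsilon>0$ such that $\gamma<\sqrt{\frac{1}{(1+\varepsilon_6)\mu^2}}$ and, for all $k\ge1$, $$1-L_{k-1}-L_k-\gamma L_k^2\mu-\frac{\gamma\beta}{2}-\frac{\gamma}{\varepsilon_5}-\frac{(\alpha+\gamma\mu(\varepsilon_5\mu+1))\left(1+\frac1{\varepsilon_6}\right)}{1-(1+\varepsilon_6)\gamma^2\mu^2}\ge\epsilon .$$ Then $(x_k)$ converges weakly to a point of $\operatorname{zer}(A+B+C)$.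 -/

import Mathlib

open Filter Topology
open scoped RealInnerProductSpace Pointwise

noncomputable section

namespace ORFBS

variable {H : Type*} [NormedAddCommGroup H] [InnerProductSpace ℝ H]

/-- The norm `‖x‖_S = √⟨S x, x⟩` induced by a bounded operator `S`
(a genuine Hilbert norm when `S` is self-adjoint and strongly monotone). -/
def normS (S : H →L[ℝ] H) (x : H) : ℝ := √(⟪S x, x⟫)

/-- The class `𝒫(H)` of self-adjoint, strongly monotone, bounded linear operators. -/
structure MemP [CompleteSpace H] (S : H →L[ℝ] H) : Prop where
  isSelfAdjoint : IsSelfAdjoint S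
  stronglyMonotone : ∃ c : ℝ, 0 < c ∧ ∀ x : H, c * ‖x‖ ^ 2 ≤ ⟪S x, x⟫

/-- Every `S ∈ 𝒫(H)` is invertible, so that `S.inverse` below really is `S⁻¹`. -/
theorem MemP.isInvertible [CompleteSpace H] {S : H →L[ℝ] H} (hS : MemP S) :
    S.IsInvertible := by
  obtain ⟨c, hc, h⟩ := hS.stronglyMonotone
  have hB : IsCoercive ((innerSL ℝ).comp S : H →L[ℝ] H →L[ℝ] ℝ) := by
    refine ⟨c, hc, fun x => ?_⟩
    have := h x
    simp only [ContinuousLinearMap.comp_apply, innerSL_apply_apply]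
    nlinarith
  refine ⟨hB.continuousLinearEquivOfBilin, ?_⟩
  ext x
  refine ext_inner_right ℝ fun y => ?_
  have := hB.continuousLinearEquivOfBilin_apply x y
  simp

/-- `T` is `L`-Lipschitz with respect to `S`: `‖T x - T y‖_{S⁻¹} ≤ L ‖x - y‖_S`. -/
def LipschitzWrt (S : H →L[ℝ] H) (L : ℝ) (T : H → H) : Prop :=
  ∀ x y : H, normS S.inverse (T x - T y) ≤ L * normS S (x - y)

/-- `T` is `c`-cocoercive with respect to `S`:
`⟨T x - T y, x - y⟩ ≥ c ‖T x - T y‖²_{S⁻¹}`. -/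
def CocoerciveWrt (S : H →L[ℝ] H) (c : ℝ) (T : H → H) : Prop :=
  ∀ x y : H, c * normS S.inverse (T x - T y) ^ 2 ≤ ⟪T x - T y, x - y⟫

/-- A single-valued operator is monotone. -/
def IsMonotone (T : H → H) : Prop :=
  ∀ x y : H, 0 ≤ ⟪T x - T y, x - y⟫

/-- A set-valued operator is maximally monotone: `u ∈ A x` if and only if
`(x, u)` is monotonically related to every point of the graph of `A`. -/
def IsMaximallyMonotone (A : H → Set H) : Prop :=
  ∀ x u : H, u ∈ A x ↔ ∀ y : H, ∀ v ∈ A y, 0 ≤ ⟪u - v, x - y⟫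

/-- The set of zeros `{x | 0 ∈ T x}` of a set-valued operator. -/
def zer (T : H → Set H) : Set H := {x | 0 ∈ T x}

/-- The inverse `T⁻¹` of a set-valued operator. -/
def setInv (T : H → Set H) (z : H) : Set H := {y | z ∈ T y}

/-- The sequence `x` delayed by one step, `k ↦ x_{k-1}`, where `xm` is the starting
point `x_{-1}`. -/
def prev (xm : H) (x : ℕ → H) : ℕ → H
  | 0 => xm
  | k + 1 => x k

/-- The sequences `x, y, u` are generated by the nonlinear outer reflected
forward-backward splitting algorithm with momentum, with kernels `M k`, constant step
size `γ` and arbitrary starting points `x 0`, `x_{-1} = xm` and `u 0`. -/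
structure IsGenerated (A : H → Set H) (B C : H → H) (S : H →L[ℝ] H) (M : ℕ → H → H)
    (γ : ℝ) (xm : H) (x y u : ℕ → H) : Prop where
  y_mem : ∀ k, y k ∈ setInv (fun z => {M k z} + A z)
    (M k (x k) - (B (x k) + C (x k)) + γ⁻¹ • u k)
  x_succ : ∀ k, x (k + 1) =
    y k - γ • S.inverse (B (x k)) + γ • S.inverse (B (prev xm x k))
  u_succ : ∀ k, u (k + 1) =
    (γ • M k (y k) - S (y k)) - (γ • M k (x k) - S (x k))

end ORFBS

end

/-! For a zero `z`, the vector `x (k+1) - z + γ S⁻¹(B (x k) - B z)` moves by exactly `y (k+1) - x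
(k+1)` at each step. Expanding its squared `S`-norm and using monotonicity of `A` and `B`,
cocoercivity of `C` and the Lipschitz bound on the momentum `u` gives `MemP.energy_step`. Adding
suitable multiples of `‖y k - x k‖_S²` and `‖x (k+1) - x k‖_S²` yields a nonnegative Lyapunov
function with summable decrease (`IsGenerated.fejer`). Hence both differences vanish, the iterates
stay bounded, and `‖w k - w(z)‖_S` converges, where `w k = x (k+1) + γ S⁻¹ B (x k)` and `w(z) = z +
γ S⁻¹ B z`.

Opial's argument thus applies to `w k` rather than to `x k`. Since `B` need not be weakly
continuous, the weak limit of `B (x k)` must be identified separately: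
`IsMaximallyMonotone.mem_of_weak_limit` does this by a Minty argument run on `A`, `B`, `C` together.
All weak limits of `w k` then coincide, and injectivity of `I + γ S⁻¹ B` carries uniqueness back to
`x k`. -/

namespace ORFBS

/-! ### Geometry of the norms induced by `S` and its inverse. -/

section WeightedNorm

variable {H : Type*} [NormedAddCommGroup H] [InnerProductSpace ℝ H]

theorem normS_nonneg (S : H →L[ℝ] H) (x : H) : 0 ≤ normS S x := Real.sqrt_nonneg _

theorem normS_neg (S : H →L[ℝ] H) (x : H) : normS S (-x) = normS S x := by
  simp only [normS, map_neg, inner_neg_neg]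

theorem CocoerciveWrt.isMonotone {S : H →L[ℝ] H} {c : ℝ} (hc : 0 ≤ c) {T : H → H}
    (hT : CocoerciveWrt S c T) : IsMonotone T :=
  fun x y => le_trans (by positivity) (hT x y)

variable [CompleteSpace H] {S : H →L[ℝ] H}

theorem MemP.apply_inverse (hS : MemP S) (x : H) : S (S.inverse x) = x :=
  hS.isInvertible.self_apply_inverse x

theorem MemP.inverse_apply (hS : MemP S) (x : H) : S.inverse (S x) = x :=
  hS.isInvertible.inverse_apply_self x

theorem MemP.inner_symm (hS : MemP S) (x y : H) : ⟪S x, y⟫ = ⟪S y, x⟫ := by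
  exact (hS.isSelfAdjoint.isSymmetric x y).trans (real_inner_comm _ _)

theorem MemP.inner_nonneg (hS : MemP S) (x : H) : 0 ≤ ⟪S x, x⟫ := by
  obtain ⟨c, hc, h⟩ := hS.stronglyMonotone
  exact le_trans (by positivity) (h x)

theorem MemP.normS_sq (hS : MemP S) (x : H) : normS S x ^ 2 = ⟪S x, x⟫ :=
  Real.sq_sqrt (hS.inner_nonneg x)

theorem MemP.normS_inverse (hS : MemP S) (u : H) :
    normS S.inverse u = normS S (S.inverse u) := by
  rw [normS, normS, hS.apply_inverse, real_inner_comm]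

/-- The norms `‖·‖` and `‖·‖_S` are equivalent. -/
theorem MemP.exists_norm_equiv (hS : MemP S) :
    ∃ K : ℝ, 0 < K ∧ (∀ x, ‖x‖ ≤ K * normS S x) ∧ ∀ x, normS S x ≤ K * ‖x‖ := by
  obtain ⟨c, hc, h⟩ := hS.stronglyMonotone
  have hsc : 0 < √c := Real.sqrt_pos.2 hc
  refine ⟨(√c)⁻¹ + √‖S‖, by positivity, fun x => ?_, fun x => ?_⟩
  · have h1 : √c * ‖x‖ ≤ normS S x := by
      apply Real.le_sqrt_of_sq_le
      rw [mul_pow, Real.sq_sqrt hc.le]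
      exact h x
    have h2 : ‖x‖ ≤ (√c)⁻¹ * normS S x := by
      rwa [← div_eq_inv_mul, le_div_iff₀' hsc]
    have h3 : 0 ≤ √‖S‖ * normS S x := mul_nonneg (Real.sqrt_nonneg _) (normS_nonneg S x)
    linarith
  · have h1 : normS S x ≤ √‖S‖ * ‖x‖ := by
      rw [normS, Real.sqrt_le_left (by positivity), mul_pow, Real.sq_sqrt (norm_nonneg _)]
      calc ⟪S x, x⟫ ≤ ‖S x‖ * ‖x‖ := real_inner_le_norm _ _
        _ ≤ ‖S‖ * ‖x‖ * ‖x‖ := by gcongr; exact S.le_opNorm x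
        _ = ‖S‖ * ‖x‖ ^ 2 := by ring
    have h2 : 0 ≤ (√c)⁻¹ * ‖x‖ := by positivity
    linarith

theorem MemP.eq_zero_of_normS_eq_zero (hS : MemP S) {x : H} (hx : normS S x = 0) : x = 0 := by
  obtain ⟨K, -, h, -⟩ := hS.exists_norm_equiv
  have := h x
  rw [hx, mul_zero] at this
  exact norm_le_zero_iff.1 this

/-- Cauchy–Schwarz for the dual pair of norms `‖·‖_{S⁻¹}` and `‖·‖_S`. -/
theorem MemP.inner_le (hS : MemP S) (u v : H) :
    ⟪u, v⟫ ≤ normS S.inverse u * normS S v := by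
  rw [hS.normS_inverse]
  obtain ⟨w, rfl⟩ : ∃ w, u = S w := ⟨_, (hS.apply_inverse u).symm⟩
  rw [hS.inverse_apply]
  set a := normS S v with ha
  set b := normS S w with hb
  have hva : a ^ 2 = ⟪S v, v⟫ := hS.normS_sq v
  have hwb : b ^ 2 = ⟪S w, w⟫ := hS.normS_sq w
  rcases (normS_nonneg S v).eq_or_lt with h0 | ha0
  · have : v = 0 := hS.eq_zero_of_normS_eq_zero h0.symm
    simp [ha, this, normS]
  rcases (normS_nonneg S w).eq_or_lt with h0 | hb0
  · have : w = 0 := hS.eq_zero_of_normS_eq_zero h0.symm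
    simp [hb, this, normS]
  -- Each vector is scaled by the norm of the other, so the expansion is `2ab(ab - ⟪S w, v⟫)`.
  have h := hS.inner_nonneg (b • v - a • w)
  simp only [map_sub, map_smul, inner_sub_left, inner_sub_right, real_inner_smul_left,
    real_inner_smul_right, ← hva, ← hwb, hS.inner_symm v w] at h
  have hab : 0 < b * a := mul_pos hb0 ha0
  refine le_of_mul_le_mul_left ?_ hab
  nlinarith

theorem MemP.two_inner_le (hS : MemP S) (u v : H) {t : ℝ} (ht : 0 < t) :
    2 * ⟪u, v⟫ ≤ t * normS S.inverse u ^ 2 + normS S v ^ 2 / t := by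
  have h := hS.inner_le u v
  have h2 : 0 ≤ (t * normS S.inverse u - normS S v) ^ 2 / t := by positivity
  have h3 : (t * normS S.inverse u - normS S v) ^ 2 / t =
      t * normS S.inverse u ^ 2 + normS S v ^ 2 / t
        - 2 * (normS S.inverse u * normS S v) := by
    field_simp
    ring
  linarith

theorem MemP.normS_add_sq (hS : MemP S) (x y : H) :
    normS S (x + y) ^ 2 = normS S x ^ 2 + 2 * ⟪S x, y⟫ + normS S y ^ 2 := by
  simp only [hS.normS_sq, map_add, inner_add_left, inner_add_right, hS.inner_symm y x]
  ring

/-- Cauchy–Schwarz, then cancellation of one dual norm. It makes Minty's trick available for `C`. -/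
theorem MemP.lipschitzWrt_of_cocoerciveWrt (hS : MemP S) {β : ℝ} (hβ : 0 < β) {T : H → H}
    (hT : CocoerciveWrt S β⁻¹ T) : LipschitzWrt S β T := by
  intro x y
  have h := (hT x y).trans (hS.inner_le _ _)
  rcases (normS_nonneg S.inverse (T x - T y)).eq_or_lt with h0 | h0
  · rw [← h0]
    exact mul_nonneg hβ.le (normS_nonneg _ _)
  · rw [← inv_mul_le_iff₀ hβ]
    refine le_of_mul_le_mul_left ?_ h0
    linarith

theorem MemP.exists_norm_le_inverse (hS : MemP S) :
    ∃ K : ℝ, 0 ≤ K ∧ ∀ u, ‖u‖ ≤ K * normS S.inverse u := by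
  obtain ⟨K, hK, h, -⟩ := hS.exists_norm_equiv
  refine ⟨‖S‖ * K, by positivity, fun u => ?_⟩
  calc ‖u‖ = ‖S (S.inverse u)‖ := by rw [hS.apply_inverse]
    _ ≤ ‖S‖ * (K * normS S (S.inverse u)) := (S.le_opNorm _).trans (by gcongr; exact h _)
    _ = ‖S‖ * K * normS S.inverse u := by rw [hS.normS_inverse]; ring

theorem LipschitzWrt.exists_norm_le (hS : MemP S) {l : ℝ} (hl : 0 ≤ l) {T : H → H}
    (hT : LipschitzWrt S l T) : ∃ K : ℝ, 0 ≤ K ∧ ∀ x y, ‖T x - T y‖ ≤ K * ‖x - y‖ := by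
  obtain ⟨K, hK, h⟩ := hS.exists_norm_le_inverse
  obtain ⟨K', hK', -, h'⟩ := hS.exists_norm_equiv
  refine ⟨K * (l * K'), by positivity, fun x y => ?_⟩
  calc ‖T x - T y‖ ≤ K * normS S.inverse (T x - T y) := h _
    _ ≤ K * (l * (K' * ‖x - y‖)) := by
      gcongr
      exact (hT x y).trans (by gcongr; exact h' _)
    _ = _ := by ring

end WeightedNorm

/-! ### One-step energy estimate. -/

section Energy

variable {H : Type*} [NormedAddCommGroup H] [InnerProductSpace ℝ H] [CompleteSpace H]
  {S : H →L[ℝ] H}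

/-- One step of the method decreases the energy `‖x - z + γ S⁻¹(B x⁻ - B z)‖_S² + 2⟨u, x - z⟩`
up to error terms. Here `b⁻, b, bz` and `c, cz` stand for the values of `B` and `C`. -/
theorem MemP.energy_step (hS : MemP S) {x y z xp u up bm b bz c cz : H}
    {γ β μ L L' P P' Q δ : ℝ} (hγ : 0 < γ) (hβ : 0 < β) (hμ : 0 < μ) (hδ : 0 < δ)
    (hL : 0 ≤ L) (hL' : 0 ≤ L')
    (hP : P = normS S (y - x))
    (ha : 0 ≤ ⟪S x - S y + u - up - γ • (b - bz) - γ • (c - cz), y - z⟫)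
    (hxp : xp = y - γ • S.inverse b + γ • S.inverse bm)
    (hb : 0 ≤ ⟪b - bz, x - z⟫)
    (hc : β⁻¹ * normS S.inverse (c - cz) ^ 2 ≤ ⟪c - cz, x - z⟫)
    (hu : normS S.inverse u ≤ L' * P') (hup : normS S.inverse up ≤ L * P)
    (hd : normS S.inverse (b - bm) ≤ μ * Q) :
    normS S (xp - z + γ • S.inverse (b - bz)) ^ 2 + 2 * ⟪up, xp - z⟫ ≤
      normS S (x - z + γ • S.inverse (bm - bz)) ^ 2 + 2 * ⟪u, x - z⟫
        - (1 - γ * β / 2 - L' - γ / δ - γ * μ * L ^ 2) * P ^ 2 + L' * P' ^ 2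
        + γ * μ * (δ * μ + 1) * Q ^ 2 := by
  have hP0 : 0 ≤ P := hP ▸ normS_nonneg _ _
  obtain ⟨X, rfl⟩ : ∃ X, y = x + X := ⟨y - x, by abel⟩
  obtain ⟨Y, rfl⟩ : ∃ Y, z = x + X - Y := ⟨x + X - z, by abel⟩
  rw [add_sub_cancel_left] at hP
  have hYX : x - (x + X - Y) = Y - X := by abel
  have hY : x + X - (x + X - Y) = Y := by abel
  rw [hY] at ha
  rw [hYX] at hb hc ⊢
  have hxpz : xp - (x + X - Y) = Y - γ • S.inverse (b - bm) := by
    rw [hxp, map_sub, smul_sub]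
    abel
  -- The reflected term telescopes: the new energy vector is the old one plus `X = y - x`.
  have hep : xp - (x + X - Y) + γ • S.inverse (b - bz)
      = (Y - X + γ • S.inverse (bm - bz)) + X := by
    rw [hxpz]
    simp only [map_sub, smul_sub]
    abel
  rw [hep, hS.normS_add_sq _ X, hxpz, ← hP]
  have hSe : ⟪S (Y - X + γ • S.inverse (bm - bz)), X⟫
      = ⟪S X, Y⟫ - P ^ 2 + γ * ⟪bm - bz, X⟫ := by
    rw [map_add, map_sub, map_smul, hS.apply_inverse, inner_add_left, inner_sub_left,
      real_inner_smul_left, hP, hS.normS_sq, hS.inner_symm Y X]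
  rw [hSe]
  -- Cocoercivity is evaluated at `x`, so `Y` is split as `(Y - X) + X`; the Young weight `2β⁻¹`
  -- exactly absorbs the cocoercive term.
  have hc2 : -2 * ⟪c - cz, Y⟫ ≤ β / 2 * P ^ 2 := by
    have h1 := hS.two_inner_le (-(c - cz)) X (t := 2 * β⁻¹) (by positivity)
    rw [normS_neg, ← hP, inner_neg_left] at h1
    rw [inner_sub_right] at hc
    have h3 : P ^ 2 / (2 * β⁻¹) = β / 2 * P ^ 2 := by field_simp
    rw [h3] at h1
    linarith
  have hu2 : 2 * ⟪u, X⟫ ≤ L' * P' ^ 2 + L' * P ^ 2 := by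
    have h1 := hS.inner_le u X
    rw [← hP] at h1
    have h2 : normS S.inverse u * P ≤ L' * P' * P := by gcongr
    nlinarith [mul_nonneg hL' (sq_nonneg (P' - P))]
  have hup2 : -2 * ⟪up, S.inverse (b - bm)⟫ ≤ μ * L ^ 2 * P ^ 2 + μ * Q ^ 2 := by
    have h1 := hS.inner_le (-up) (S.inverse (b - bm))
    rw [← hS.normS_inverse, normS_neg, inner_neg_left] at h1
    have h2 : normS S.inverse up * normS S.inverse (b - bm) ≤ L * P * (μ * Q) := by
      gcongr
      exact normS_nonneg _ _
    nlinarith [mul_nonneg hμ.le (sq_nonneg (L * P - Q))]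
  have hd2 : -2 * ⟪b - bm, X⟫ ≤ δ * μ ^ 2 * Q ^ 2 + P ^ 2 / δ := by
    have h1 := hS.two_inner_le (-(b - bm)) X hδ
    rw [normS_neg, ← hP, inner_neg_left] at h1
    have h3 : normS S.inverse (b - bm) ^ 2 ≤ (μ * Q) ^ 2 := by
      gcongr
      exact normS_nonneg _ _
    have h4 := mul_le_mul_of_nonneg_left h3 hδ.le
    linarith
  have e1 := mul_le_mul_of_nonneg_left hc2 hγ.le
  have e2 := mul_le_mul_of_nonneg_left hup2 hγ.le
  have e3 := mul_le_mul_of_nonneg_left hd2 hγ.le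
  have e4 := mul_nonneg hγ.le hb
  have e5 : γ / δ * P ^ 2 = γ * (P ^ 2 / δ) := by ring
  have hSxX : S x - S (x + X) = -S X := by rw [map_add]; abel
  rw [hSxX] at ha
  simp only [inner_sub_left, inner_sub_right, inner_add_left, inner_neg_left,
    real_inner_smul_left, real_inner_smul_right] at ha e1 e2 e3 e4 ⊢
  linarith

end Energy

/-! ### Weak limits along filters and Minty arguments. -/

section WeakLimits

variable {H : Type*} [NormedAddCommGroup H] [InnerProductSpace ℝ H] {ι : Type*}

/-- Bounded families in a Hilbert space have weak limits along ultrafilters. -/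
theorem exists_weak_limit [CompleteSpace H] (U : Ultrafilter ι) {x : ι → H} {K : ℝ}
    (hx : ∀ k, ‖x k‖ ≤ K) :
    ∃ x' : H, ∀ v, Tendsto (fun k => ⟪x k, v⟫) U (𝓝 ⟪x', v⟫) := by
  have h : ∀ v, ∃ l, Tendsto (fun k => ⟪x k, v⟫) U (𝓝 l) ∧ |l| ≤ K * ‖v‖ := by
    intro v
    obtain ⟨l, hl, hlim⟩ := (isCompact_Icc (a := -(K * ‖v‖)) (b := K * ‖v‖)).ultrafilter_le_nhds'
      (U.map fun k => ⟪x k, v⟫) (Ultrafilter.mem_map.2 <| Filter.univ_mem' fun k =>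
        abs_le.1 ((abs_real_inner_le_norm _ _).trans
          (mul_le_mul_of_nonneg_right (hx k) (norm_nonneg v))))
    exact ⟨l, hlim, abs_le.2 hl⟩
  choose l hl hb using h
  let f : H →ₗ[ℝ] ℝ :=
    { toFun := l
      map_add' := fun v w => tendsto_nhds_unique (hl (v + w)) <| by
        simpa only [inner_add_right] using (hl v).add (hl w)
      map_smul' := fun c v => tendsto_nhds_unique (hl (c • v)) <| by
        simpa only [real_inner_smul_right] using! (hl v).const_mul c }
  refine ⟨(InnerProductSpace.toDual ℝ H).symm (f.mkContinuous K hb), fun v => ?_⟩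
  rw [InnerProductSpace.toDual_symm_apply]
  exact hl v

theorem tendsto_inner_zero_of_bounded {F : Filter ι} {g x : ι → H} {K : ℝ}
    (hg : Tendsto g F (𝓝 0)) (hx : ∀ k, ‖x k‖ ≤ K) :
    Tendsto (fun k => ⟪g k, x k⟫) F (𝓝 0) := by
  have h : Tendsto (fun k => ‖g k‖ * K) F (𝓝 0) := by
    simpa using hg.norm.mul_const K
  refine squeeze_zero_norm (fun k => ?_) h
  exact (norm_inner_le_norm _ _).trans (by gcongr; exact hx k)

theorem tendsto_toWeakSpace_of_inner [CompleteSpace H] {F : Filter ι} {x : ι → H} {x' : H}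
    (h : ∀ v, Tendsto (fun k => ⟪x k, v⟫) F (𝓝 ⟪x', v⟫)) :
    Tendsto (fun k => toWeakSpace ℝ H (x k)) F (𝓝 (toWeakSpace ℝ H x')) := by
  have hinj : Function.Injective (topDualPairing ℝ H).flip := fun p q hpq =>
    ext_inner_left ℝ fun v => DFunLike.congr_fun hpq (innerSL ℝ v)
  refine (WeakBilin.tendsto_iff_forall_eval_tendsto _ hinj).2 fun f => ?_
  have := h ((InnerProductSpace.toDual ℝ H).symm f)
  simp only [real_inner_comm ((InnerProductSpace.toDual ℝ H).symm f),
    InnerProductSpace.toDual_symm_apply] at this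
  exact this

/-- Minty's trick for a Lipschitz operator. -/
theorem eq_of_forall_inner_nonneg {T : H → H} {K : ℝ} (hK : 0 ≤ K)
    (hT : ∀ x y, ‖T x - T y‖ ≤ K * ‖x - y‖) {x b : H}
    (h : ∀ r, 0 ≤ ⟪b - T r, x - r⟫) : b = T x := by
  set w := T x - b with hw
  -- Minty's perturbation `x - t • w` usually needs `t → 0`; for a `K`-Lipschitz map, one fixed `t`
  -- with `K * t < 1` suffices.
  set t : ℝ := (K + 1)⁻¹ with ht
  have ht0 : 0 < t := by positivity
  have hKt : K * t < 1 := by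
    rw [ht, ← div_eq_mul_inv, div_lt_one (by linarith)]
    linarith
  have h1 := h (x - t • w)
  rw [sub_sub_cancel, real_inner_smul_right] at h1
  have h2 : 0 ≤ ⟪b - T (x - t • w), w⟫ := nonneg_of_mul_nonneg_right h1 ht0
  have h3 : b - T (x - t • w) = (T x - T (x - t • w)) - w := by rw [hw]; abel
  rw [h3, inner_sub_left, real_inner_self_eq_norm_sq] at h2
  have h4 : ⟪T x - T (x - t • w), w⟫ ≤ K * t * ‖w‖ ^ 2 := by
    calc ⟪T x - T (x - t • w), w⟫ ≤ ‖T x - T (x - t • w)‖ * ‖w‖ := real_inner_le_norm _ _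
      _ ≤ K * ‖x - (x - t • w)‖ * ‖w‖ := by gcongr; exact hT _ _
      _ = K * t * ‖w‖ ^ 2 := by
        rw [sub_sub_cancel, norm_smul, Real.norm_of_nonneg ht0.le]
        ring
  have h5 : ‖w‖ ^ 2 ≤ 0 := by nlinarith [sq_nonneg ‖w‖]
  have h6 : w = 0 := by
    rw [← norm_eq_zero]
    exact pow_eq_zero_iff two_ne_zero |>.1 (le_antisymm h5 (sq_nonneg _))
  exact (sub_eq_zero.1 h6).symm

theorem IsMaximallyMonotone.inner_nonneg {A : H → Set H} (hA : IsMaximallyMonotone A)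
    {x y u v : H} (hu : u ∈ A x) (hv : v ∈ A y) : 0 ≤ ⟪u - v, x - y⟫ :=
  (hA x u).1 hu y v hv

/-- Weak limits of asymptotic solutions of `0 ∈ A y + B x + C x` are solutions, and the values
of `B` and `C` converge weakly to their values at the limit. -/
theorem IsMaximallyMonotone.mem_of_weak_limit {A : H → Set H} (hA : IsMaximallyMonotone A)
    {B C : H → H} (hB : IsMonotone B) (hC : IsMonotone C) {KB KC K : ℝ}
    (hKB : 0 ≤ KB) (hKC : 0 ≤ KC)
    (hBl : ∀ x y, ‖B x - B y‖ ≤ KB * ‖x - y‖) (hCl : ∀ x y, ‖C x - C y‖ ≤ KC * ‖x - y‖)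
    {F : Filter ι} [F.NeBot] {x y a : ι → H} (ha : ∀ k, a k ∈ A (y k))
    (hg : Tendsto (fun k => a k + B (x k) + C (x k)) F (𝓝 0))
    (hyx : Tendsto (fun k => y k - x k) F (𝓝 0))
    (hy : ∀ k, ‖y k‖ ≤ K) (hBC : ∀ k, ‖B (x k) + C (x k)‖ ≤ K) {x' b c : H}
    (hx' : ∀ v, Tendsto (fun k => ⟪x k, v⟫) F (𝓝 ⟪x', v⟫))
    (hb : ∀ v, Tendsto (fun k => ⟪B (x k), v⟫) F (𝓝 ⟪b, v⟫))
    (hc : ∀ v, Tendsto (fun k => ⟪C (x k), v⟫) F (𝓝 ⟪c, v⟫)) :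
    -(B x' + C x') ∈ A x' ∧ b = B x' ∧ c = C x' := by
  -- In the sum of the three monotonicity inequalities, the products of two weakly convergent
  -- sequences cancel because `a k + B (x k) + C (x k)` and `y k - x k` tend strongly to zero. Three
  -- independent test points remain; two are set to `x'` below to isolate each operator.
  have key : ∀ p, ∀ v ∈ A p, ∀ r s,
      0 ≤ ⟪-(b + c) - v, x' - p⟫ + ⟪b - B r, x' - r⟫ + ⟪c - C s, x' - s⟫ := by
    intro p v hv r s
    have l1 := tendsto_inner_zero_of_bounded hg (x := fun k => y k - p) (K := K + ‖p‖)
      fun k => (norm_sub_le _ _).trans (by gcongr; exact hy k)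
    have l2 := tendsto_inner_zero_of_bounded hyx (x := fun k => B (x k) + C (x k) + v)
      (K := K + ‖v‖) fun k => (norm_add_le _ _).trans (by gcongr; exact hBC k)
    have l3 := (((hb (p - r)).add (hc (p - s))).sub
      ((hx' v).add ((hx' (B r)).add (hx' (C s))))).add_const (⟪v, p⟫ + ⟪B r, r⟫ + ⟪C s, s⟫)
    have l4 := (l1.sub l2).add l3
    have h0 := ge_of_tendsto' l4 (b := 0) fun k => by
      have h1 := hA.inner_nonneg (ha k) hv
      have h2 := hB (x k) r
      have h3 := hC (x k) s
      simp only [inner_sub_left, inner_sub_right, inner_add_left, inner_add_right] at h1 h2 h3 ⊢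
      rw [real_inner_comm (B (x k)) (y k), real_inner_comm (C (x k)) (y k),
        real_inner_comm v (y k), real_inner_comm v (x k), real_inner_comm (B r) (x k),
        real_inner_comm (C s) (x k), real_inner_comm (B (x k)) (x k),
        real_inner_comm (C (x k)) (x k)]
      linarith
    simp only [inner_sub_left, inner_sub_right, inner_add_left, inner_neg_left] at h0 ⊢
    rw [real_inner_comm x' v, real_inner_comm x' (B r), real_inner_comm x' (C s)]
    linarith
  have hmem : -(b + c) ∈ A x' := (hA _ _).2 fun p v hv => by
    simpa using key p v hv x' x'
  have hbB : b = B x' := eq_of_forall_inner_nonneg hKB hBl fun r => by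
    simpa using key x' _ hmem r x'
  have hcC : c = C x' := eq_of_forall_inner_nonneg hKC hCl fun s => by
    simpa using key x' _ hmem x' s
  exact ⟨hbB ▸ hcC ▸ hmem, hbB, hcC⟩

end WeakLimits

/-! ### Estimates along the generated sequences. -/

section Iteration

theorem mem_zer_iff {H : Type*} [NormedAddCommGroup H] {A : H → Set H} {B C : H → H} {z : H} :
    z ∈ zer (fun x => A x + {B x} + {C x}) ↔ -(B z + C z) ∈ A z := by
  simp only [zer, Set.mem_ofPred_eq, Set.add_singleton, Set.image_image, Set.mem_image]
  constructor
  · rintro ⟨a, ha, h⟩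
    rwa [← eq_neg_of_add_eq_zero_left ((add_assoc _ _ _).symm.trans h)]
  · exact fun h => ⟨_, h, by abel⟩

variable {H : Type*} [NormedAddCommGroup H] [InnerProductSpace ℝ H]
  {A : H → Set H} {B C : H → H} {S : H →L[ℝ] H} {M : ℕ → H → H} {xm : H} {x y u : ℕ → H}
  {γ β μ : ℝ} {L : ℕ → ℝ}

/-- The definition of `u (k + 1)` eliminates the nonlinear kernel `M k` from the inclusion, leaving
only `S` and the momentum terms. -/
theorem IsGenerated.residual_mem (hγ : 0 < γ) (hgen : IsGenerated A B C S M γ xm x y u) (k : ℕ) :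
    γ⁻¹ • (S (x k) - S (y k) + u k - u (k + 1)) - (B (x k) + C (x k)) ∈ A (y k) := by
  have h := hgen.y_mem k
  simp only [setInv, Set.mem_ofPred_eq, Set.singleton_add, Set.mem_image] at h
  obtain ⟨a, ha, h⟩ := h
  convert! ha using 1
  rw [← sub_eq_iff_eq_add'.2 h.symm, hgen.u_succ k]
  simp only [smul_sub, smul_add, inv_smul_smul₀ hγ.ne']
  abel

/-- The energy of the iterate `x (k + 1)` relative to the point `z`. -/
noncomputable def energy (S : H →L[ℝ] H) (B : H → H) (γ : ℝ) (x u : ℕ → H) (z : H) (k : ℕ) : ℝ :=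
  normS S (x (k + 1) - z + γ • S.inverse (B (x k) - B z)) ^ 2 + 2 * ⟪u (k + 1), x (k + 1) - z⟫

theorem IsGenerated.normS_u_succ_le
    (hM : ∀ k, LipschitzWrt S (L k) (fun x => γ • M k x - S x))
    (hgen : IsGenerated A B C S M γ xm x y u) (k : ℕ) :
    normS S.inverse (u (k + 1)) ≤ L k * normS S (y k - x k) := by
  rw [hgen.u_succ k]
  exact hM k _ _

variable [CompleteSpace H]

theorem IsGenerated.energy_succ_le (hS : MemP S) (hA : IsMaximallyMonotone A) (hμ : 0 < μ)
    (hBmono : IsMonotone B) (hBlip : LipschitzWrt S μ B) (hβ : 0 < β)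
    (hC : CocoerciveWrt S β⁻¹ C) (hγ : 0 < γ) (hL : ∀ k, 0 ≤ L k)
    (hM : ∀ k, LipschitzWrt S (L k) (fun x => γ • M k x - S x))
    (hgen : IsGenerated A B C S M γ xm x y u) {z : H} (hz : -(B z + C z) ∈ A z)
    {δ : ℝ} (hδ : 0 < δ) (k : ℕ) :
    energy S B γ x u z (k + 1) ≤ energy S B γ x u z k
      - (1 - γ * β / 2 - L k - γ / δ - γ * μ * L (k + 1) ^ 2)
        * normS S (y (k + 1) - x (k + 1)) ^ 2
      + L k * normS S (y k - x k) ^ 2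
      + γ * μ * (δ * μ + 1) * normS S (x (k + 1) - x k) ^ 2 := by
  refine hS.energy_step (c := C (x (k + 1))) (cz := C z) hγ hβ hμ hδ (hL _) (hL _) rfl ?_
    (hgen.x_succ (k + 1)) (hBmono _ _) (hC _ _) (hgen.normS_u_succ_le hM k)
    (hgen.normS_u_succ_le hM (k + 1)) (hBlip _ _)
  have h := mul_nonneg hγ.le (hA.inner_nonneg (hgen.residual_mem hγ (k + 1)) hz)
  rw [← real_inner_smul_left] at h
  convert! h using 2
  simp only [smul_sub, smul_add, smul_neg, smul_inv_smul₀ hγ.ne']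
  abel

/-- The step is `y - x` minus the reflected correction; Young's inequality with weight `δ` separates
them. The resulting recursion contracts when the first coefficient is below one. -/
theorem IsGenerated.normS_step_sq_le (hS : MemP S) (hBlip : LipschitzWrt S μ B)
    (hgen : IsGenerated A B C S M γ xm x y u) {δ : ℝ} (hδ : 0 < δ) (k : ℕ) :
    normS S (x (k + 2) - x (k + 1)) ^ 2 ≤
      (1 + δ) * γ ^ 2 * μ ^ 2 * normS S (x (k + 1) - x k) ^ 2
        + (1 + 1 / δ) * normS S (y (k + 1) - x (k + 1)) ^ 2 := by
  set d := B (x (k + 1)) - B (x k) with hd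
  have hx : x (k + 2) - x (k + 1) = -(γ • S.inverse d) + (y (k + 1) - x (k + 1)) := by
    rw [hgen.x_succ (k + 1), hd, map_sub, smul_sub]
    simp only [prev]
    abel
  have hn : normS S (-(γ • S.inverse d)) ^ 2 = γ ^ 2 * normS S.inverse d ^ 2 := by
    rw [normS_neg, hS.normS_inverse, hS.normS_sq, hS.normS_sq, map_smul, real_inner_smul_left,
      real_inner_smul_right]
    ring
  have hy := hS.two_inner_le (S (-(γ • S.inverse d))) (y (k + 1) - x (k + 1)) hδ
  rw [hS.normS_inverse, hS.inverse_apply, hn] at hy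
  rw [hx, hS.normS_add_sq, hn]
  have hl : normS S.inverse d ^ 2 ≤ (μ * normS S (x (k + 1) - x k)) ^ 2 := by
    gcongr
    · exact normS_nonneg _ _
    · exact hBlip _ _
  have hl2 := mul_le_mul_of_nonneg_left hl (by positivity : 0 ≤ (1 + δ) * γ ^ 2)
  have e : (1 + 1 / δ) * normS S (y (k + 1) - x (k + 1)) ^ 2
    = normS S (y (k + 1) - x (k + 1)) ^ 2 + normS S (y (k + 1) - x (k + 1)) ^ 2 / δ := by ring
  rw [e]
  linarith

/-- The energy is bounded below by a weighted distance to `z`. -/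
theorem IsGenerated.le_energy (hS : MemP S) (hBmono : IsMonotone B)
    (hBlip : LipschitzWrt S μ B) (hγ : 0 < γ) (hL : ∀ k, 0 ≤ L k)
    (hM : ∀ k, LipschitzWrt S (L k) (fun x => γ • M k x - S x))
    (hgen : IsGenerated A B C S M γ xm x y u) (z : H) (k : ℕ) :
    (1 - L k) * normS S (x (k + 1) - z) ^ 2
      - 2 * γ * μ * normS S (x (k + 1) - x k) * normS S (x (k + 1) - z)
      - L k * normS S (y k - x k) ^ 2 ≤ energy S B γ x u z k := by
  set D := x (k + 1) - z with hD
  set P := normS S (y k - x k)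
  set Q := normS S (x (k + 1) - x k)
  have hX := normS_nonneg S D
  rw [energy, ← hD, hS.normS_add_sq]
  have h1 : ⟪S D, γ • S.inverse (B (x k) - B z)⟫ = γ * ⟪B (x k) - B z, D⟫ := by
    rw [hS.inner_symm, map_smul, hS.apply_inverse, real_inner_smul_left]
  have h2 : -(μ * Q * normS S D) ≤ ⟪B (x k) - B z, D⟫ := by
    have h3 := hBmono (x (k + 1)) z
    have h4 := hS.inner_le (B (x (k + 1)) - B (x k)) D
    have h5 : normS S.inverse (B (x (k + 1)) - B (x k)) * normS S D ≤ μ * Q * normS S D := by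
      gcongr
      exact hBlip _ _
    rw [← hD] at h3
    have h6 : ⟪B (x k) - B z, D⟫
        = ⟪B (x (k + 1)) - B z, D⟫ - ⟪B (x (k + 1)) - B (x k), D⟫ := by
      rw [← inner_sub_left]
      congr 1
      abel
    linarith
  have h7 := hS.inner_le (-u (k + 1)) D
  rw [normS_neg, inner_neg_left] at h7
  have h8 : normS S.inverse (u (k + 1)) * normS S D ≤ L k * P * normS S D := by
    gcongr
    exact hgen.normS_u_succ_le hM k
  have h9 := mul_nonneg (hL k) (sq_nonneg (P - normS S D))
  have h10 := mul_le_mul_of_nonneg_left h2 hγ.le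
  have h11 := sq_nonneg (normS S (γ • S.inverse (B (x k) - B z)))
  rw [h1]
  linarith

/-- A nonnegative sequence that decreases by at least `r k` at every step converges, and
`r` tends to zero. -/
theorem exists_tendsto_of_succ_le_sub {F r : ℕ → ℝ} (hF : ∀ k, 0 ≤ F k) (hr : ∀ k, 0 ≤ r k)
    (h : ∀ k, F (k + 1) ≤ F k - r k) :
    (∃ l, Tendsto F atTop (𝓝 l)) ∧ Tendsto r atTop (𝓝 0) := by
  have hanti : Antitone F := antitone_nat_of_succ_le fun k => by linarith [h k, hr k]
  have hl := tendsto_atTop_ciInf hanti ⟨0, by rintro _ ⟨k, rfl⟩; exact hF k⟩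
  refine ⟨⟨_, hl⟩, squeeze_zero (g := fun k => F k - F (k + 1)) hr
    (fun k => by linarith [h k]) ?_⟩
  simpa using hl.sub (hl.comp (tendsto_add_atTop_nat 1))

end Iteration

/-! ### Lyapunov decrease and uniqueness of limits. -/

section Convergence

variable {H : Type*} [NormedAddCommGroup H] [InnerProductSpace ℝ H] [CompleteSpace H]
  {A : H → Set H} {B C : H → H} {S : H →L[ℝ] H} {M : ℕ → H → H} {xm : H} {x y u : ℕ → H}
  {γ β μ : ℝ} {L : ℕ → ℝ}

/-- Fejér-type convergence relative to a zero `z`. -/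
theorem IsGenerated.fejer (hS : MemP S) (hA : IsMaximallyMonotone A) (hμ : 0 < μ)
    (hBmono : IsMonotone B) (hBlip : LipschitzWrt S μ B) (hβ : 0 < β)
    (hC : CocoerciveWrt S β⁻¹ C) (hγ : 0 < γ) (hL : ∀ k, 0 ≤ L k ∧ L k < 1)
    (hM : ∀ k, LipschitzWrt S (L k) (fun x => γ • M k x - S x))
    {ε₅ ε₆ α ε : ℝ} (hε₅ : 0 < ε₅) (hε₆ : 0 < ε₆) (hα : 0 < α) (hε : 0 < ε)
    (hi : ∀ k : ℕ, 1 ≤ k →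
      ε ≤ 1 - L (k - 1) - L k - γ * L k ^ 2 * μ - γ * β / 2 - γ / ε₅
        - (α + γ * μ * (ε₅ * μ + 1)) * (1 + 1 / ε₆) / (1 - (1 + ε₆) * γ ^ 2 * μ ^ 2))
    (hγ_lt : γ < √(1 / ((1 + ε₆) * μ ^ 2)))
    (hgen : IsGenerated A B C S M γ xm x y u) {z : H} (hz : -(B z + C z) ∈ A z) :
    Tendsto (fun k => normS S (y k - x k)) atTop (𝓝 0) ∧
    Tendsto (fun k => normS S (x (k + 1) - x k)) atTop (𝓝 0) ∧
    (∃ K, ∀ k, normS S (x (k + 1) - z) ≤ K) ∧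
    ∃ l, Tendsto (fun k => normS S (x (k + 1) - z + γ • S.inverse (B (x k) - B z)) ^ 2)
      atTop (𝓝 l) := by
  set θ := (1 + ε₆) * γ ^ 2 * μ ^ 2 with hθ
  set κ := 1 + 1 / ε₆ with hκ
  set ρ := γ * μ * (ε₅ * μ + 1) with hρ
  have hθ1 : 0 < 1 - θ := by
    have h := (Real.lt_sqrt hγ.le).1 hγ_lt
    rw [lt_div_iff₀ (by positivity)] at h
    rw [hθ]
    linarith
  have hθ0 : 0 < θ := by positivity
  have hκ1 : 1 ≤ κ := by
    have : 0 < 1 / ε₆ := by positivity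
    linarith
  have hργ : γ * μ ≤ ρ := by
    have : 0 ≤ γ * μ * (ε₅ * μ) := by positivity
    rw [hρ]
    linarith
  have hγμ : 0 < γ * μ := mul_pos hγ hμ
  -- Chosen so that `lam * θ + ρ = lam - α`: the weighted recursion for `Q` pays for the energy
  -- error `ρ * Q k ^ 2` and leaves a decrease `α * Q k ^ 2`.
  obtain ⟨lam, hlam⟩ : ∃ lam, lam = (α + ρ) / (1 - θ) := ⟨_, rfl⟩
  have hlamθ : lam * (1 - θ) = α + ρ := by
    rw [hlam]
    exact div_mul_cancel₀ _ hθ1.ne'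
  have hlam0 : 0 < lam := by
    rw [hlam]
    exact div_pos (by linarith) hθ1
  have hlamγ : γ * μ ≤ lam := by
    have := mul_pos hlam0 hθ0
    linarith
  have hlamκ : lam ≤ lam * κ := le_mul_of_one_le_right hlam0.le hκ1
  -- The energy of index `k` involves `u (k + 1)`, so the arbitrary `u 0` and `xm` never enter and
  -- the condition from index one on is enough.
  have hi' : ∀ k, ε ≤ 1 - L k - L (k + 1) - γ * μ * L (k + 1) ^ 2 - γ * β / 2 - γ / ε₅
      - lam * κ := by
    intro k
    have h := hi (k + 1) (by omega)
    have e : (α + ρ) * κ / (1 - θ) = lam * κ := by rw [hlam]; ring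
    rw [Nat.add_sub_cancel, e] at h
    linarith
  set P : ℕ → ℝ := fun k => normS S (y k - x k) with hP
  set Q : ℕ → ℝ := fun k => normS S (x (k + 1) - x k) with hQ
  set D : ℕ → ℝ := fun k => normS S (x (k + 1) - z) with hD
  have hP0 : ∀ k, 0 ≤ P k := fun k => normS_nonneg _ _
  have hQ0 : ∀ k, 0 ≤ Q k := fun k => normS_nonneg _ _
  have hD0 : ∀ k, 0 ≤ D k := fun k => normS_nonneg _ _
  set F : ℕ → ℝ := fun k => energy S B γ x u z k + L k * P k ^ 2 + lam * Q k ^ 2 with hF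
  have hFD : ∀ k, ε * D k ^ 2 ≤ F k := by
    intro k
    have h1 : _ ≤ energy S B γ x u z k :=
      hgen.le_energy hS hBmono hBlip hγ (fun k => (hL k).1) hM z k
    have h2 : ε + lam ≤ 1 - L k := by
      have := hi' k
      have h3 : 0 ≤ γ * μ * L (k + 1) ^ 2 := by positivity
      have h4 : 0 < γ * β / 2 := by positivity
      have h5 : 0 < γ / ε₅ := by positivity
      have h6 := (hL (k + 1)).1
      linarith
    have h3 := mul_le_mul_of_nonneg_right h2 (sq_nonneg (D k))
    have h4 := mul_nonneg hlam0.le (sq_nonneg (D k - Q k))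
    have h5 := mul_nonneg (sub_nonneg.2 hlamγ) (mul_nonneg (hQ0 k) (hD0 k))
    simp only [hF, hP, hQ, hD] at *
    linarith
  have hF0 : ∀ k, 0 ≤ F k := fun k => le_trans (by positivity) (hFD k)
  have hdec : ∀ k, F (k + 1) ≤ F k - (ε * P (k + 1) ^ 2 + α * Q k ^ 2) := by
    intro k
    have h1 : energy S B γ x u z (k + 1) ≤ energy S B γ x u z k
        - (1 - γ * β / 2 - L k - γ / ε₅ - γ * μ * L (k + 1) ^ 2) * P (k + 1) ^ 2
        + L k * P k ^ 2 + ρ * Q k ^ 2 :=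
      hgen.energy_succ_le hS hA hμ hBmono hBlip hβ hC hγ (fun k => (hL k).1) hM hz hε₅ k
    have h2 : Q (k + 1) ^ 2 ≤ θ * Q k ^ 2 + κ * P (k + 1) ^ 2 :=
      hgen.normS_step_sq_le hS hBlip hε₆ k
    have h3 := mul_le_mul_of_nonneg_left h2 hlam0.le
    have h4 := mul_le_mul_of_nonneg_right (hi' k) (sq_nonneg (P (k + 1)))
    have h5 : (lam * (1 - θ)) * Q k ^ 2 = (α + ρ) * Q k ^ 2 := by rw [hlamθ]
    simp only [hF]
    linarith
  obtain ⟨⟨l, hl⟩, hr⟩ := exists_tendsto_of_succ_le_sub hF0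
    (fun k => by positivity) hdec
  have hP2 : Tendsto (fun k => P (k + 1) ^ 2) atTop (𝓝 0) := by
    refine squeeze_zero (fun k => sq_nonneg _) (fun k => ?_)
      (by simpa using hr.const_mul ε⁻¹)
    rw [← div_eq_inv_mul, le_div_iff₀' hε]
    linarith [mul_nonneg hα.le (sq_nonneg (Q k))]
  have hQ2 : Tendsto (fun k => Q k ^ 2) atTop (𝓝 0) := by
    refine squeeze_zero (fun k => sq_nonneg _) (fun k => ?_)
      (by simpa using hr.const_mul α⁻¹)
    rw [← div_eq_inv_mul, le_div_iff₀' hα]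
    linarith [mul_nonneg hε.le (sq_nonneg (P (k + 1)))]
  have hQt : Tendsto Q atTop (𝓝 0) := by
    simpa [Real.sqrt_sq (hQ0 _)] using hQ2.sqrt
  have hPt : Tendsto P atTop (𝓝 0) := by
    rw [← tendsto_add_atTop_iff_nat 1]
    simpa [Real.sqrt_sq (hP0 _)] using hP2.sqrt
  have hbdd : ∃ K, ∀ k, D k ≤ K := by
    obtain ⟨K, hK⟩ := hl.bddAbove_range
    refine ⟨√(K / ε), fun k => Real.le_sqrt_of_sq_le ?_⟩
    rw [le_div_iff₀' hε]
    exact (hFD k).trans (hK ⟨k, rfl⟩)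
  obtain ⟨K, hK⟩ := hbdd
  refine ⟨hPt, hQt, ⟨K, hK⟩, l, ?_⟩
  have hu : Tendsto (fun k => 2 * ⟪u (k + 1), x (k + 1) - z⟫) atTop (𝓝 0) := by
    have h0 : Tendsto (fun k => 2 * (P k * K)) atTop (𝓝 0) := by
      simpa using (hPt.mul_const K).const_mul 2
    have hn : ∀ k, normS S.inverse (u (k + 1)) * D k ≤ P k * K := fun k => by
      have h1 := hgen.normS_u_succ_le hM k
      have h2 : L k * P k ≤ P k := mul_le_of_le_one_left (hP0 k) (hL k).2.le
      exact mul_le_mul (h1.trans h2) (hK k) (hD0 k) (hP0 k)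
    refine squeeze_zero_norm (fun k => ?_) h0
    rw [Real.norm_eq_abs, abs_le]
    have h1 := hS.inner_le (u (k + 1)) (x (k + 1) - z)
    have h2 := hS.inner_le (-u (k + 1)) (x (k + 1) - z)
    rw [normS_neg, inner_neg_left] at h2
    have h3 := hn k
    simp only [hD] at h3
    constructor <;> linarith
  have hLP : Tendsto (fun k => L k * P k ^ 2) atTop (𝓝 0) := by
    have hP2' : Tendsto (fun k => P k ^ 2) atTop (𝓝 0) := by simpa using hPt.pow 2
    exact squeeze_zero (fun k => mul_nonneg (hL k).1 (sq_nonneg _))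
      (fun k => mul_le_of_le_one_left (sq_nonneg _) (hL k).2.le) hP2'
  -- All other terms of `F` vanish in the limit, leaving the squared norm.
  have h := ((hl.sub hu).sub hLP).sub (hQ2.const_mul lam)
  simp only [hF, energy, mul_zero, sub_zero] at h
  convert! h using 2
  ring

theorem MemP.tendsto_zero_of_normS (hS : MemP S) {ι : Type*} {F : Filter ι} {v : ι → H}
    (hv : Tendsto (fun k => normS S (v k)) F (𝓝 0)) : Tendsto v F (𝓝 0) := by
  obtain ⟨K, -, h, -⟩ := hS.exists_norm_equiv
  exact squeeze_zero_norm (fun k => h _) (by simpa using hv.const_mul K)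

/-- Uniqueness of limits along different filters, in the spirit of Opial's lemma. -/
theorem MemP.eq_of_tendsto_normS_sub (hS : MemP S) {ι : Type*} {G F₁ F₂ : Filter ι}
    [F₁.NeBot] [F₂.NeBot] (h₁ : F₁ ≤ G) (h₂ : F₂ ≤ G) {w : ι → H} {w₁ w₂ : H} {l₁ l₂ : ℝ}
    (hl₁ : Tendsto (fun k => normS S (w k - w₁) ^ 2) G (𝓝 l₁))
    (hl₂ : Tendsto (fun k => normS S (w k - w₂) ^ 2) G (𝓝 l₂))
    (hw₁ : ∀ v, Tendsto (fun k => ⟪S (w k), v⟫) F₁ (𝓝 ⟪S w₁, v⟫))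
    (hw₂ : ∀ v, Tendsto (fun k => ⟪S (w k), v⟫) F₂ (𝓝 ⟪S w₂, v⟫)) : w₁ = w₂ := by
  -- Subtracting the two squared distances cancels `⟪S (w k), w k⟫`, so this pairing converges along
  -- all of `G`, and both weak limits must agree on `w₁ - w₂`.
  have h : Tendsto (fun k => ⟪S (w k), w₁ - w₂⟫) G
      (𝓝 (((l₂ - l₁) + (⟪S w₁, w₁⟫ - ⟪S w₂, w₂⟫)) / 2)) := by
    refine (((hl₂.sub hl₁).add_const _).div_const 2).congr fun k => ?_
    simp only [hS.normS_sq, map_sub, inner_sub_left, inner_sub_right, hS.inner_symm w₁ (w k),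
      hS.inner_symm w₂ (w k)]
    ring
  have e₁ := tendsto_nhds_unique (hw₁ _) (h.mono_left h₁)
  have e₂ := tendsto_nhds_unique (hw₂ _) (h.mono_left h₂)
  have h0 : normS S (w₁ - w₂) ^ 2 = 0 := by
    rw [hS.normS_sq, map_sub, inner_sub_left, e₁, e₂, sub_self]
  exact sub_eq_zero.1 (hS.eq_zero_of_normS_eq_zero (pow_eq_zero_iff two_ne_zero |>.1 h0))

/-- Equal images give `S (z - z') = -γ (B z - B z')`; pairing with `z - z'` makes `‖z - z'‖_S²`
nonpositive. -/
theorem MemP.injective_add_smul_inverse (hS : MemP S) (hγ : 0 ≤ γ) (hB : IsMonotone B) :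
    Function.Injective fun z => z + γ • S.inverse (B z) := by
  intro z z' h
  have h1 : z - z' = -(γ • S.inverse (B z - B z')) := by
    rw [map_sub, smul_sub, neg_sub]
    exact sub_eq_sub_iff_add_eq_add.2 (h.trans (add_comm _ _))
  have h2 : normS S (z - z') ^ 2 ≤ 0 := by
    rw [hS.normS_sq]
    nth_rewrite 1 [h1]
    rw [map_neg, map_smul, hS.apply_inverse, inner_neg_left, real_inner_smul_left,
      Left.neg_nonpos_iff]
    exact mul_nonneg hγ (hB _ _)
  have h3 := pow_eq_zero_iff two_ne_zero |>.1 (le_antisymm h2 (sq_nonneg _))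
  exact sub_eq_zero.1 (hS.eq_zero_of_normS_eq_zero h3)

end Convergence

/-! ### Identification of weak cluster points. -/

section WeakClusterPoints

theorem exists_norm_le_of_lipschitz {H : Type*} [NormedAddCommGroup H] {T : H → H} {K c : ℝ} (hK : 0 ≤ K)
    (hT : ∀ x y, ‖T x - T y‖ ≤ K * ‖x - y‖) {v : ℕ → H} {z : H} (hv : ∀ k, ‖v k - z‖ ≤ c) :
    ∀ k, ‖T (v k)‖ ≤ K * c + ‖T z‖ := fun k =>
  calc ‖T (v k)‖ = ‖(T (v k) - T z) + T z‖ := by rw [sub_add_cancel]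
    _ ≤ K * ‖v k - z‖ + ‖T z‖ := (norm_add_le _ _).trans (by gcongr; exact hT _ _)
    _ ≤ K * c + ‖T z‖ := by gcongr; exact hv k

variable {H : Type*} [NormedAddCommGroup H] [InnerProductSpace ℝ H] [CompleteSpace H]
  {A : H → Set H} {B C : H → H} {S : H →L[ℝ] H} {M : ℕ → H → H} {xm : H} {x y u : ℕ → H}
  {γ β μ : ℝ} {L : ℕ → ℝ}

/-- Along every ultrafilter the iterates converge weakly to a zero `z'`, and
`x_{k+1} + γ S⁻¹ B x_k` converges weakly to `z' + γ S⁻¹ B z'`. -/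
theorem IsGenerated.exists_weak_limit_mem (hS : MemP S) (hA : IsMaximallyMonotone A)
    (hμ : 0 < μ) (hBmono : IsMonotone B) (hBlip : LipschitzWrt S μ B) (hβ : 0 < β)
    (hC : CocoerciveWrt S β⁻¹ C) (hγ : 0 < γ) (hL : ∀ k, 0 ≤ L k ∧ L k < 1)
    (hM : ∀ k, LipschitzWrt S (L k) (fun x => γ • M k x - S x))
    (hgen : IsGenerated A B C S M γ xm x y u)
    (hP : Tendsto (fun k => normS S (y k - x k)) atTop (𝓝 0))
    (hQ : Tendsto (fun k => normS S (x (k + 1) - x k)) atTop (𝓝 0))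
    {z : H} {K : ℝ} (hK : ∀ k, normS S (x (k + 1) - z) ≤ K)
    (U : Ultrafilter ℕ) (hU : (U : Filter ℕ) ≤ atTop) :
    ∃ z', -(B z' + C z') ∈ A z' ∧
      (∀ v, Tendsto (fun k => ⟪x (k + 1), v⟫) U (𝓝 ⟪z', v⟫)) ∧
      ∀ v, Tendsto (fun k => ⟪S (x (k + 1) + γ • S.inverse (B (x k))), v⟫) U
        (𝓝 ⟪S (z' + γ • S.inverse (B z')), v⟫) := by
  obtain ⟨K₁, hK₁, hn, -⟩ := hS.exists_norm_equiv
  obtain ⟨K₂, hK₂, hn'⟩ := hS.exists_norm_le_inverse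
  obtain ⟨KB, hKB, hBl⟩ := hBlip.exists_norm_le hS hμ.le
  obtain ⟨KC, hKC, hCl⟩ := (hS.lipschitzWrt_of_cocoerciveWrt hβ hC).exists_norm_le hS hβ.le
  have hxz : ∀ k, ‖x (k + 1) - z‖ ≤ K₁ * K := fun k => (hn _).trans (by gcongr; exact hK k)
  have hBb := exists_norm_le_of_lipschitz hKB hBl hxz
  have hCb := exists_norm_le_of_lipschitz hKC hCl hxz
  have hxb : ∀ k, ‖x (k + 1)‖ ≤ K₁ * K + ‖z‖ := fun k => by
    have := norm_add_le (x (k + 1) - z) z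
    rw [sub_add_cancel] at this
    linarith [hxz k]
  have hyx : Tendsto (fun k => y (k + 1) - x (k + 1)) atTop (𝓝 0) :=
    (hS.tendsto_zero_of_normS hP).comp (tendsto_add_atTop_nat 1)
  have hxx : Tendsto (fun k => x (k + 1) - x k) atTop (𝓝 0) := hS.tendsto_zero_of_normS hQ
  obtain ⟨Ky, hKy⟩ := hyx.norm.bddAbove_range
  have hyb : ∀ k, ‖y (k + 1)‖ ≤ Ky + (K₁ * K + ‖z‖) := fun k => by
    have h1 := norm_add_le (y (k + 1) - x (k + 1)) (x (k + 1))
    rw [sub_add_cancel] at h1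
    have h2 : ‖y (k + 1) - x (k + 1)‖ ≤ Ky := hKy ⟨k, rfl⟩
    linarith [hxb k]
  have hu : Tendsto (fun k => u (k + 1)) atTop (𝓝 0) := by
    refine squeeze_zero_norm (fun k => ?_) (by simpa using hP.const_mul K₂)
    have h1 := hgen.normS_u_succ_le hM k
    have h2 := mul_le_of_le_one_left (normS_nonneg S (y k - x k)) (hL k).2.le
    exact (hn' _).trans (by gcongr; exact h1.trans h2)
  have hg : Tendsto (fun k => γ⁻¹ • (S (x (k + 1)) - S (y (k + 1)) + u (k + 1) - u (k + 2)))
      atTop (𝓝 0) := by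
    have h1 := (S.continuous.tendsto 0).comp hyx
    have h2 := ((h1.neg.add hu).sub (hu.comp (tendsto_add_atTop_nat 1))).const_smul γ⁻¹
    simp only [map_zero, neg_zero, add_zero, sub_zero, smul_zero] at h2
    refine h2.congr fun k => ?_
    simp only [Function.comp_apply, map_sub, neg_sub]
  obtain ⟨z', hz'⟩ := exists_weak_limit U hxb
  obtain ⟨b, hb⟩ := exists_weak_limit U hBb
  obtain ⟨c, hc⟩ := exists_weak_limit U hCb
  have hres : Tendsto (fun k => (γ⁻¹ • (S (x (k + 1)) - S (y (k + 1)) + u (k + 1) - u (k + 2))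
      - (B (x (k + 1)) + C (x (k + 1)))) + B (x (k + 1)) + C (x (k + 1))) U (𝓝 0) := by
    refine (hg.mono_left hU).congr fun k => ?_
    abel
  have hBC := fun k => (norm_add_le (B (x (k + 1))) (C (x (k + 1)))).trans
    (add_le_add (hBb k) (hCb k))
  obtain ⟨hmem, rfl, -⟩ := hA.mem_of_weak_limit hBmono (hC.isMonotone (inv_pos.2 hβ).le) hKB hKC
    hBl hCl (fun k => hgen.residual_mem hγ (k + 1)) hres (hyx.mono_left hU)
    (fun k => (hyb k).trans (le_max_left _ _)) (fun k => (hBC k).trans (le_max_right _ _))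
    hz' hb hc
  refine ⟨z', hmem, hz', fun v => ?_⟩
  -- The weak limit was identified for `B (x (k + 1))`; vanishing steps transfer it to the delayed
  -- `B (x k)`.
  have hd : Tendsto (fun k => B (x (k + 1)) - B (x k)) atTop (𝓝 0) :=
    squeeze_zero_norm (fun k => hBl _ _) (by simpa using hxx.norm.const_mul KB)
  have hdv : Tendsto (fun k => ⟪B (x (k + 1)) - B (x k), v⟫) U (𝓝 0) :=
    tendsto_inner_zero_of_bounded (hd.mono_left hU) fun _ => le_refl ‖v‖
  have h := (hz' (S v)).add (((hb v).sub hdv).const_mul γ)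
  have hsymm : ∀ p q : H, ⟪S p, q⟫ = ⟪p, S q⟫ := hS.isSelfAdjoint.isSymmetric
  simp only [map_add, map_smul, hS.apply_inverse, inner_add_left, real_inner_smul_left, hsymm]
  rw [sub_zero] at h
  refine h.congr fun k => ?_
  rw [inner_sub_left]
  ring

end WeakClusterPoints

end ORFBS

theorem mainTheorem3 {H : Type*} [NormedAddCommGroup H] [InnerProductSpace ℝ H]
    [CompleteSpace H]
    (A : H → Set H) (B C : H → H) (S : H →L[ℝ] H) (M : ℕ → H → H)
    (μ β γ : ℝ) (L : ℕ → ℝ)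
    (hS : ORFBS.MemP S)
    (hA : ORFBS.IsMaximallyMonotone A)
    (hμ : 0 < μ) (hBmono : ORFBS.IsMonotone B) (hBlip : ORFBS.LipschitzWrt S μ B)
    (hβ : 0 < β) (hC : ORFBS.CocoerciveWrt S β⁻¹ C)
    (hzer : (ORFBS.zer (fun x => A x + {B x} + {C x})).Nonempty)
    (hγ : 0 < γ)
    (hL : ∀ k, 0 ≤ L k ∧ L k < 1)
    (hM : ∀ k, ORFBS.LipschitzWrt S (L k) (fun x => γ • M k x - S x))
    (ε₅ ε₆ α ε : ℝ) (hε₅ : 0 < ε₅) (hε₆ : 0 < ε₆) (hα : 0 < α) (hε : 0 < ε)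
    (hi : ∀ k : ℕ, 1 ≤ k →
      ε ≤ 1 - L (k - 1) - L k - γ * L k ^ 2 * μ - γ * β / 2 - γ / ε₅
        - (α + γ * μ * (ε₅ * μ + 1)) * (1 + 1 / ε₆) / (1 - (1 + ε₆) * γ ^ 2 * μ ^ 2))
    (hγ_lt : γ < √(1 / ((1 + ε₆) * μ ^ 2)))
    (xm : H) (x y u : ℕ → H)
    (hgen : ORFBS.IsGenerated A B C S M γ xm x y u) :
    ∃ x' ∈ ORFBS.zer (fun x => A x + {B x} + {C x}),
      Tendsto (fun k => toWeakSpace ℝ H (x k)) atTop (𝓝 (toWeakSpace ℝ H x')) := by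
  obtain ⟨z, hz⟩ := hzer
  have hfejer := fun {z : H} => hgen.fejer (z := z) hS hA hμ hBmono hBlip hβ hC hγ hL hM hε₅ hε₆
    hα hε hi hγ_lt
  obtain ⟨hP, hQ, ⟨K, hK⟩, -⟩ := hfejer (ORFBS.mem_zer_iff.1 hz)
  have hlim := hgen.exists_weak_limit_mem hS hA hμ hBmono hBlip hβ hC hγ hL hM hP hQ hK
  have hfejer' : ∀ z', -(B z' + C z') ∈ A z' → ∃ l, Tendsto (fun k =>
      ORFBS.normS S (x (k + 1) + γ • S.inverse (B (x k)) - (z' + γ • S.inverse (B z'))) ^ 2)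
      atTop (𝓝 l) := fun z' hz' => by
    obtain ⟨-, -, -, l, hl⟩ := hfejer hz'
    refine ⟨l, hl.congr fun k => ?_⟩
    rw [map_sub, smul_sub, add_sub_add_comm]
  -- One ultrafilter supplies the candidate limit; the limit along every other one is then compared
  -- with it.
  obtain ⟨x', hx', -, hw'⟩ := hlim (Ultrafilter.of atTop) (Ultrafilter.of_le _)
  obtain ⟨l', hl'⟩ := hfejer' x' hx'
  refine ⟨x', ORFBS.mem_zer_iff.2 hx', ?_⟩
  rw [← tendsto_add_atTop_iff_nat 1, tendsto_iff_ultrafilter]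
  intro U hU
  obtain ⟨x'', hx'', hweak, hw''⟩ := hlim U hU
  obtain ⟨l'', hl''⟩ := hfejer' x'' hx''
  have heq := hS.eq_of_tendsto_normS_sub hU (Ultrafilter.of_le _) hl'' hl' hw'' hw'
  rw [← hS.injective_add_smul_inverse hγ.le hBmono heq]
  exact ORFBS.tendsto_toWeakSpace_of_inner hweak
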